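/- For an integer $s \ge 1$ and real numbers $T$, $a > 0$ and $a' > 0$, let $$\Gamma(s,T,a) := \Big\{ k \in \mathbb{N}_0^s : \prod_{i=1}^s (k_i + a) \le T \Big\}$$ be the corner hyperbolic cross (a finite set, with cardinality $|\Gamma(s,T,a)|$), and let $$I(s,T,a') := \int_{P(s,T,a')} dx, \qquad P(s,T,a') := \Big\{ x \in [0,\infty)^s : \prod_{j=1}^s (x_j + a') \le T \Big\},$$ be the volume of the corner smooth hyperbolic cross. Theorem. For every integer $s \ge 2$ and every real $a > \tfrac12$ there exists $T_* = T_*(s,a) > 0$ such that $$|\Gamma(s,T,a)| \le I\big(s,T,a-\tfrac12\big) \qquad \text{for all real } T \ge T_*(s,a).$$ -/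

import Mathlib

open MeasureTheory

/-- The corner continuous hyperbolic cross: all `k ∈ ℕ₀ˢ` with `∏ (kᵢ + a) ≤ T`. -/
def cornerCross (s : ℕ) (T a : ℝ) : Set (Fin s → ℕ) :=
  {k | ∏ i, ((k i : ℝ) + a) ≤ T}

/-- The corner smooth hyperbolic cross: all `x ∈ ℝˢ` with nonnegative coordinates and
`∏ (xⱼ + a') ≤ T`. -/
def smoothCross (s : ℕ) (T a' : ℝ) : Set (Fin s → ℝ) :=
  {x | (∀ j, 0 ≤ x j) ∧ ∏ j, (x j + a') ≤ T}

/-- The volume `I(s, T, a')` of the corner smooth hyperbolic cross. -/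
noncomputable def smoothCrossVolume (s : ℕ) (T a' : ℝ) : ℝ :=
  ∫ _x in smoothCross s T a', (1 : ℝ)

/-!
Write `N s T` for the number of points of the corner hyperbolic cross with shift `a`, and `V s T`
for the volume of the smooth cross with shift `b = a - 1 / 2 > 0`. What is proved is the stronger
statement that for each `s ≥ 2` there is `c > 0` with `N s T + c * T ≤ V s T` for all large `T`.
The linear gain makes induction on `s` possible.

*Dimension two* (`linear_gain_two`). The hyperbola method (`ncard_cornerCross_two_le`) gives
`N 2 T ≤ 2 T ∑_{j < M} 1 / (j + a) - T + O(√T)` with `M = √T + O(1)`, while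
`V 2 T ≥ T log (T / b ^ 2) - T` by direct integration. As `j + a` is the midpoint of
`[j + b, j + 1 + b]` and `1 / x` is convex, the sum is at most `log ((M + b) / b) - δ`, where
`δ = log (1 + 1 / b) - 1 / (b + 1 / 2) > 0` comes from the first interval alone. Hence
`V 2 T - N 2 T ≥ 2 δ T - O(√T)`.

*Induction step* (`linear_gain_succ`). Slicing along the first coordinate gives
`N (s + 1) T = ∑ k, N s (T / (k + a))` and `V (s + 1) T = ∫ x ≥ 0, V s (T / (x + b))`. The function
`y ↦ V s (T / y)` is midpoint convex for `s ≥ 1`: this is elementary for `s = 1` and passes through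
the integral formula (`volume_smoothCross_midpoint`). So `∑ k, V s (T / (k + a)) ≤ V (s + 1) T`
(`sum_smoothCrossVolume_le`). On the slices where the induction hypothesis applies, the gain is
`c * T * ∑ 1 / (k + a)`, with an arbitrarily large factor because the harmonic series diverges; on
each of the remaining `O(T)` slices the loss is bounded by a constant.
-/

/-! ### Finiteness and monotonicity -/

theorem le_div_pow_of_prod_add_le {s : ℕ} {T b : ℝ} (hb : 0 < b) {y : Fin (s + 1) → ℝ}
    (hy : ∀ i, 0 ≤ y i) (h : ∏ i, (y i + b) ≤ T) (j : Fin (s + 1)) : y j ≤ T / b ^ s := by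
  rw [le_div_iff₀ (by positivity)]
  refine le_trans ?_ h
  rw [← Finset.mul_prod_erase _ _ (Finset.mem_univ j)]
  have h1 : b ^ s ≤ ∏ i ∈ Finset.univ.erase j, (y i + b) := by
    have : ∏ _i ∈ Finset.univ.erase j, b ≤ ∏ i ∈ Finset.univ.erase j, (y i + b) :=
      Finset.prod_le_prod (fun _ _ => hb.le) fun i _ => by linarith [hy i]
    simpa using this
  exact mul_le_mul (by linarith) h1 (by positivity) (by linarith [hy j])

theorem cornerCross_finite (s : ℕ) (T : ℝ) {a : ℝ} (ha : 0 < a) : (cornerCross s T a).Finite := by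
  cases s with
  | zero => exact Set.toFinite _
  | succ s =>
    refine (Set.Finite.pi' fun _ : Fin (s + 1) => Set.finite_Iic ⌊T / a ^ s⌋₊).subset ?_
    intro k hk j
    exact Nat.le_floor (le_div_pow_of_prod_add_le ha (fun i => Nat.cast_nonneg (k i)) hk j)

theorem cornerCross_mono (s : ℕ) (a : ℝ) {T T' : ℝ} (h : T ≤ T') :
    cornerCross s T a ⊆ cornerCross s T' a := fun _ hk => le_trans hk h

theorem smoothCross_mono (s : ℕ) (b : ℝ) {T T' : ℝ} (h : T ≤ T') :
    smoothCross s T b ⊆ smoothCross s T' b := fun _ hk => ⟨hk.1, hk.2.trans h⟩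

theorem volume_smoothCross_lt_top (s : ℕ) (T : ℝ) {b : ℝ} (hb : 0 < b) :
    volume (smoothCross s T b) < ⊤ := by
  cases s with
  | zero => exact (measure_mono (Set.subset_univ _)).trans_lt (by simp [volume_pi])
  | succ s =>
    refine (measure_mono (t := Set.Icc 0 fun _ => T / b ^ s) fun x hx => ?_).trans_lt
      isCompact_Icc.measure_lt_top
    exact ⟨hx.1, fun j => le_div_pow_of_prod_add_le hb hx.1 hx.2 j⟩

theorem smoothCrossVolume_eq_toReal (s : ℕ) (T b : ℝ) :
    smoothCrossVolume s T b = (volume (smoothCross s T b)).toReal := by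
  simp [smoothCrossVolume, Measure.real]

/-! ### Slicing and convexity of the volume -/

theorem measurable_volume_smoothCross (s : ℕ) (b : ℝ) :
    Measurable fun T => volume (smoothCross s T b) :=
  Monotone.measurable fun _ _ h => measure_mono (smoothCross_mono s b h)

/-- Slicing along the first coordinate. -/
theorem volume_smoothCross_succ (s : ℕ) (T : ℝ) {b : ℝ} (hb : 0 < b) :
    volume (smoothCross (s + 1) T b) =
      ∫⁻ x in Set.Ici (0 : ℝ), volume (smoothCross s (T / (x + b)) b) := by
  have hmp := volume_preserving_piFinSuccAbove (fun _ : Fin (s + 1) => ℝ) 0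
  set A : Set (ℝ × (Fin s → ℝ)) :=
    {p | 0 ≤ p.1 ∧ (∀ j, 0 ≤ p.2 j) ∧ (p.1 + b) * ∏ j, (p.2 j + b) ≤ T} with hA
  have hAm : MeasurableSet A := by
    refine IsClosed.measurableSet ?_
    simp only [hA, Set.ofPred_and, Set.ofPred_forall]
    refine (isClosed_le (by fun_prop) (by fun_prop)).inter
      ((isClosed_iInter fun j => isClosed_le (by fun_prop) (by fun_prop)).inter
        (isClosed_le (by fun_prop) (by fun_prop)))
  have hpre : smoothCross (s + 1) T b =
      (MeasurableEquiv.piFinSuccAbove (fun _ : Fin (s + 1) => ℝ) 0) ⁻¹' A := by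
    ext x
    simp [smoothCross, hA, Fin.forall_fin_succ, Fin.prod_univ_succ, and_assoc,
      MeasurableEquiv.piFinSuccAbove, Fin.insertNthEquiv, Fin.tail]
  rw [hpre, hmp.measure_preimage hAm.nullMeasurableSet, Measure.volume_eq_prod,
    Measure.prod_apply hAm, ← lintegral_indicator measurableSet_Ici]
  refine lintegral_congr fun x => ?_
  by_cases hx : 0 ≤ x
  · rw [Set.indicator_of_mem (by exact hx)]
    congr 1
    ext y
    simp [hA, smoothCross, hx, le_div_iff₀ (by linarith : 0 < x + b), mul_comm]
  · rw [Set.indicator_of_notMem (by exact hx)]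
    have : Prod.mk x ⁻¹' A = ∅ := by
      ext y; simp [hA, hx]
    simp [this]

theorem volume_smoothCross_one (T b : ℝ) :
    volume (smoothCross 1 T b) = ENNReal.ofReal (T - b) := by
  have : smoothCross 1 T b = Set.Icc 0 fun _ => T - b := by
    ext x
    simp [smoothCross, Pi.le_def, le_sub_iff_add_le]
  rw [this, Real.volume_Icc_pi]
  simp

/-- Midpoint convexity on `y > 0` of the volume with parameter `T / y`. In dimension one it is the
positive part of `T / y - b`; slicing transfers it to the next dimension, the slice at `x` having
parameter `T / (y * (x + b))`. In dimension zero it fails. -/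
theorem volume_smoothCross_midpoint (s : ℕ) {b : ℝ} (hb : 0 < b) {T : ℝ} (hT : 0 ≤ T) {m t : ℝ}
    (h₁ : 0 < m - t) (h₂ : 0 < m + t) :
    2 * volume (smoothCross (s + 1) (T / m) b) ≤
      volume (smoothCross (s + 1) (T / (m - t)) b) +
        volume (smoothCross (s + 1) (T / (m + t)) b) := by
  induction s generalizing m t with
  | zero =>
    have hm : 0 < m := by linarith
    have h1 : ∀ T, volume (smoothCross (0 + 1) T b) = ENNReal.ofReal (T - b) :=
      fun T => volume_smoothCross_one T b
    simp only [h1]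
    have key : 2 * (T / m - b) ≤ (T / (m - t) - b) + (T / (m + t) - b) := by
      have : (T / (m - t) - b) + (T / (m + t) - b) - 2 * (T / m - b) =
          2 * T * t ^ 2 / (m * (m - t) * (m + t)) := by
        field_simp
        ring
      have : 0 ≤ 2 * T * t ^ 2 / (m * (m - t) * (m + t)) := by positivity
      linarith
    calc 2 * ENNReal.ofReal (T / m - b) = ENNReal.ofReal (2 * (T / m - b)) := by
          rw [ENNReal.ofReal_mul (by norm_num)]; simp
      _ ≤ _ := (ENNReal.ofReal_le_ofReal key).trans ENNReal.ofReal_add_le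
  | succ s ih =>
    rw [volume_smoothCross_succ _ _ hb, volume_smoothCross_succ _ _ hb,
      volume_smoothCross_succ _ _ hb]
    have hmeas : ∀ y : ℝ, Measurable fun x : ℝ =>
        volume (smoothCross (s + 1) (T / y / (x + b)) b) := fun y =>
      (measurable_volume_smoothCross (s + 1) b).comp (by fun_prop)
    rw [← lintegral_const_mul _ (hmeas m), ← lintegral_add_left (hmeas _)]
    refine setLIntegral_mono' measurableSet_Ici fun x hx => ?_
    have hxb : 0 < x + b := by have : (0 : ℝ) ≤ x := hx; linarith
    have := ih (m := m * (x + b)) (t := t * (x + b))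
      (by rw [← sub_mul]; positivity) (by rw [← add_mul]; positivity)
    rwa [← sub_mul, ← add_mul, ← div_div, ← div_div, ← div_div] at this

/-! ### Comparison of sums with integrals -/

/-- The Hermite–Hadamard inequality: the value at the midpoint `k + 1 / 2` of an interval is at most
the integral over it. This is where the shift by `1 / 2` between the two crosses enters. -/
theorem volume_smoothCross_le_lintegral (s : ℕ) {b : ℝ} (hb : 0 < b) {T : ℝ} (hT : 0 ≤ T) (k : ℕ) :
    volume (smoothCross (s + 1) (T / (k + (b + 1 / 2))) b) ≤
      ∫⁻ x in Set.Ico (k : ℝ) (k + 1), volume (smoothCross (s + 1) (T / (x + b)) b) := by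
  set F : ℝ → ENNReal := fun x => volume (smoothCross (s + 1) (T / (x + b)) b) with hF
  have hFm : Measurable F := (measurable_volume_smoothCross (s + 1) b).comp (by fun_prop)
  -- reflection of the interval in its midpoint
  have hrefl : ∫⁻ x in Set.Ico (k : ℝ) (k + 1), F x =
      ∫⁻ x in Set.Ioc (k : ℝ) (k + 1), F (2 * k + 1 - x) := by
    have hmp := Measure.measurePreserving_sub_left (volume : Measure ℝ) (2 * k + 1)
    have := hmp.setLIntegral_comp_preimage (measurableSet_Ico (a := (k : ℝ)) (b := k + 1)) hFm
    rw [← this]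
    congr 2
    ext x
    simp only [Set.mem_preimage, Set.mem_Ico, Set.mem_Ioc]
    constructor <;> rintro ⟨h1, h2⟩ <;> constructor <;> linarith
  rw [setLIntegral_congr (Ico_ae_eq_Ioc (μ := volume))] at hrefl
  rw [setLIntegral_congr (Ico_ae_eq_Ioc (μ := volume))]
  have h2 : 2 * volume (smoothCross (s + 1) (T / (k + (b + 1 / 2))) b) ≤
      2 * ∫⁻ x in Set.Ioc (k : ℝ) (k + 1), F x := by
    rw [two_mul (∫⁻ x in Set.Ioc (k : ℝ) (k + 1), F x)]
    nth_rewrite 2 [hrefl]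
    rw [← lintegral_add_left hFm]
    calc _ = ∫⁻ _x in Set.Ioc (k : ℝ) (k + 1),
          2 * volume (smoothCross (s + 1) (T / (k + (b + 1 / 2))) b) := by simp
      _ ≤ _ := by
        refine setLIntegral_mono' measurableSet_Ioc fun x hx => ?_
        have hk : (0 : ℝ) ≤ k := Nat.cast_nonneg k
        have := volume_smoothCross_midpoint s hb hT (m := k + (b + 1 / 2))
          (t := k + 1 / 2 - x) (by linarith [hx.1]) (by linarith [hx.2])
        convert this using 5 <;> ring
  exact (ENNReal.mul_le_mul_iff_right (by norm_num) (by norm_num)).1 h2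

theorem sum_volume_smoothCross_le (s : ℕ) {b : ℝ} (hb : 0 < b) {T : ℝ} (hT : 0 ≤ T) (K : ℕ) :
    ∑ k ∈ Finset.range K, volume (smoothCross (s + 1) (T / (k + (b + 1 / 2))) b) ≤
      volume (smoothCross (s + 2) T b) := by
  rw [volume_smoothCross_succ _ _ hb]
  refine (Finset.sum_le_sum fun k _ => volume_smoothCross_le_lintegral s hb hT k).trans ?_
  rw [← lintegral_biUnion_finset ?_ fun _ _ => measurableSet_Ico]
  · refine lintegral_mono_set (Set.iUnion₂_subset fun k _ x hx => ?_)
    exact (Nat.cast_nonneg k).trans hx.1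
  · intro i _ j _ hij
    rw [Function.onFun, Set.disjoint_left]
    rintro x ⟨h1, h2⟩ ⟨h3, h4⟩
    have h5 : i < j + 1 := by exact_mod_cast h1.trans_lt h4
    have h6 : j < i + 1 := by exact_mod_cast h3.trans_lt h2
    omega

theorem sum_smoothCrossVolume_le (s : ℕ) {b : ℝ} (hb : 0 < b) {T : ℝ} (hT : 0 ≤ T)
    (K : ℕ) :
    ∑ k ∈ Finset.range K, smoothCrossVolume (s + 1) (T / (k + (b + 1 / 2))) b ≤
      smoothCrossVolume (s + 2) T b := by
  simp only [smoothCrossVolume_eq_toReal]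
  rw [← ENNReal.toReal_sum fun k _ => (volume_smoothCross_lt_top _ _ hb).ne]
  exact ENNReal.toReal_mono (volume_smoothCross_lt_top _ _ hb).ne
    (sum_volume_smoothCross_le s hb hT K)

/-! ### Propagation of a linear gain to the next dimension -/

/-- Slicing along the first coordinate; slices with `k > T / a ^ s` are empty. -/
theorem ncard_cornerCross_succ_le (s : ℕ) (T : ℝ) {a : ℝ} (ha : 0 < a) :
    (cornerCross (s + 1) T a).ncard ≤
      ∑ k ∈ Finset.range (⌊T / a ^ s⌋₊ + 1), (cornerCross s (T / (k + a)) a).ncard := by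
  have hsub : cornerCross (s + 1) T a ⊆ ⋃ k ∈ Finset.range (⌊T / a ^ s⌋₊ + 1),
      (fun y : Fin s → ℕ => (Fin.cons k y : Fin (s + 1) → ℕ)) '' cornerCross s (T / (k + a)) a := by
    intro x hx
    have h0 : x 0 ≤ ⌊T / a ^ s⌋₊ :=
      Nat.le_floor (le_div_pow_of_prod_add_le ha (fun i => Nat.cast_nonneg (x i)) hx 0)
    refine Set.mem_biUnion (Finset.mem_coe.2 (Finset.mem_range.2 (Nat.lt_succ_of_le h0)))
      ⟨Fin.tail x, ?_, Fin.cons_self_tail x⟩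
    have hpos : (0 : ℝ) < x 0 + a := by positivity
    have hx' : ∏ i, ((x i : ℝ) + a) ≤ T := hx
    rw [Fin.prod_univ_succ] at hx'
    change ∏ i : Fin s, ((x i.succ : ℝ) + a) ≤ _
    rwa [le_div_iff₀' hpos]
  refine (Set.ncard_le_ncard hsub ?_).trans ((Finset.set_ncard_biUnion_le _ _).trans
    (Finset.sum_le_sum fun k _ => Set.ncard_image_le (cornerCross_finite s _ ha)))
  exact Set.Finite.biUnion (Finset.finite_toSet _) fun k _ =>
    (cornerCross_finite s _ ha).image _

/-- The harmonic series shifted by `a` diverges. -/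
theorem exists_le_sum_one_div_add {a : ℝ} (ha : 0 < a) (B : ℝ) :
    ∃ L : ℕ, B ≤ ∑ k ∈ Finset.range L, 1 / ((k : ℝ) + a) := by
  obtain ⟨L, hL⟩ := (Real.tendsto_sum_range_one_div_nat_succ_atTop.eventually_ge_atTop
    (B * (1 + a))).exists
  refine ⟨L, ?_⟩
  rw [← le_div_iff₀ (by positivity)] at hL
  refine hL.trans ?_
  rw [Finset.sum_div]
  refine Finset.sum_le_sum fun k _ => ?_
  rw [div_div]
  exact one_div_le_one_div_of_le (by positivity)
    (by nlinarith [mul_nonneg (Nat.cast_nonneg (α := ℝ) k) ha.le])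

/-- A linear gain propagates to the next dimension. The slices on which the gain
is available contribute a gain of `c * T` times a partial sum of the harmonic series, which
outgrows the bounded loss on each of the `O(T)` remaining slices. -/
theorem linear_gain_succ (s : ℕ) {a : ℝ} (ha : 1 / 2 < a) {c T₀ : ℝ} (hc : 0 < c)
    (h : ∀ T, T₀ ≤ T → ((cornerCross (s + 1) T a).ncard : ℝ) + c * T ≤
      smoothCrossVolume (s + 1) T (a - 1 / 2)) :
    ∃ T₁, ∀ T, T₁ ≤ T → ((cornerCross (s + 2) T a).ncard : ℝ) + c * T ≤
      smoothCrossVolume (s + 2) T (a - 1 / 2) := by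
  have ha0 : 0 < a := by linarith
  have hb : 0 < a - 1 / 2 := by linarith
  set C : ℝ := ((cornerCross (s + 1) T₀ a).ncard : ℝ) with hC
  have hC0 : 0 ≤ C := Nat.cast_nonneg _
  have hV0 : ∀ T, 0 ≤ smoothCrossVolume (s + 1) T (a - 1 / 2) := fun T => by
    rw [smoothCrossVolume_eq_toReal]; exact ENNReal.toReal_nonneg
  -- below `T₀` the count is at most its value at `T₀`, so the loss never exceeds the constant `C`
  have hbound : ∀ T, 0 ≤ T → ((cornerCross (s + 1) T a).ncard : ℝ) ≤
      smoothCrossVolume (s + 1) T (a - 1 / 2) + C := by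
    intro T hT
    rcases le_total T₀ T with hT₀ | hT₀
    · linarith [h T hT₀, mul_nonneg hc.le hT]
    · have : ((cornerCross (s + 1) T a).ncard : ℝ) ≤ C :=
        Nat.cast_le.2 (Set.ncard_le_ncard (cornerCross_mono _ _ hT₀) (cornerCross_finite _ _ ha0))
      linarith [hV0 T]
  -- at most `T / a ^ (s + 1) + 1` slices are nonempty, so a gain of `C / a ^ (s + 1)` per unit of
  -- `T` pays for all losses but one `C`, the `1` pays for that `C` once `C ≤ T`, and `c` is kept
  obtain ⟨L, hL⟩ := exists_le_sum_one_div_add ha0 ((c + C / a ^ (s + 1) + 1) / c)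
  refine ⟨max (max 0 C) (max (T₀ * (L + a)) (L * a ^ (s + 1))), fun T hT => ?_⟩
  simp only [max_le_iff] at hT
  obtain ⟨⟨hT0, hTC⟩, hTL, hTL'⟩ := hT
  set K := ⌊T / a ^ (s + 1)⌋₊ + 1 with hK
  have hLK : L ≤ K := (Nat.le_floor ((le_div_iff₀ (by positivity)).2 hTL')).trans (Nat.le_succ _)
  have hKT : (K : ℝ) ≤ T / a ^ (s + 1) + 1 := by
    rw [hK]; push_cast
    linarith [Nat.floor_le (show 0 ≤ T / a ^ (s + 1) by positivity)]
  have hterm : ∀ k ∈ Finset.range K, ((cornerCross (s + 1) (T / (k + a)) a).ncard : ℝ) ≤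
      smoothCrossVolume (s + 1) (T / (k + a)) (a - 1 / 2) + C -
        if k < L then c * T * (1 / (k + a)) else 0 := by
    intro k _
    have hka : 0 < (k : ℝ) + a := by positivity
    split_ifs with hk
    · have hkL : (k : ℝ) ≤ L := by exact_mod_cast hk.le
      have h1 : T₀ ≤ T / (k + a) := by
        rw [le_div_iff₀ hka]
        rcases le_total 0 T₀ with h0 | h0
        · exact (mul_le_mul_of_nonneg_left (by linarith) h0).trans hTL
        · exact (mul_nonpos_of_nonpos_of_nonneg h0 hka.le).trans hT0
      have h2 := h _ h1
      rw [mul_assoc, mul_one_div]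
      linarith
    · rw [sub_zero]
      exact hbound _ (by positivity)
  have hsumif : ∑ k ∈ Finset.range K, (if k < L then c * T * (1 / ((k : ℝ) + a)) else 0) =
      c * T * ∑ k ∈ Finset.range L, 1 / ((k : ℝ) + a) := by
    rw [← Finset.sum_filter, Finset.mul_sum]
    congr 1
    ext k
    simp only [Finset.mem_filter, Finset.mem_range]
    omega
  have hN : ((cornerCross (s + 2) T a).ncard : ℝ) ≤
      ∑ k ∈ Finset.range K, ((cornerCross (s + 1) (T / (k + a)) a).ncard : ℝ) := by
    exact_mod_cast ncard_cornerCross_succ_le (s + 1) T ha0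
  have hV := sum_smoothCrossVolume_le s hb hT0 K
  simp only [sub_add_cancel] at hV
  have hsum := Finset.sum_le_sum hterm
  rw [Finset.sum_sub_distrib, Finset.sum_add_distrib, hsumif, Finset.sum_const, Finset.card_range,
    nsmul_eq_mul] at hsum
  have hgain : (c + C / a ^ (s + 1) + 1) * T ≤ c * T * ∑ k ∈ Finset.range L, 1 / ((k : ℝ) + a) := by
    rw [div_le_iff₀' hc] at hL
    nlinarith [mul_le_mul_of_nonneg_right hL hT0]
  have hKC : K * C ≤ C / a ^ (s + 1) * T + C := by
    calc K * C ≤ (T / a ^ (s + 1) + 1) * C := mul_le_mul_of_nonneg_right hKT hC0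
      _ = _ := by ring
  linarith

/-! ### The two-dimensional case -/

/-- The hyperbola method. Splitting at `M`, the largest number with `(M - 1 + a) ^ 2 ≤ T`, every
lattice point has a coordinate less than `M`; those with both coordinates less than `M` are counted
once. -/
theorem ncard_cornerCross_two_le {T a : ℝ} (ha : 0 < a) (haT : a ^ 2 ≤ T) :
    ((cornerCross 2 T a).ncard : ℝ) ≤
      ∑ j ∈ Finset.range ⌊√T - a + 1⌋₊,
        (2 * (T / (j + a) - a + 1) - (⌊√T - a + 1⌋₊ : ℝ)) := by
  have hr : a ≤ √T := Real.le_sqrt_of_sq_le haT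
  have hT : 0 ≤ T := (sq_nonneg a).trans haT
  have hrT : √T * √T = T := Real.mul_self_sqrt hT
  set M := ⌊√T - a + 1⌋₊ with hM
  have hltM : ∀ k : ℕ, k < M ↔ (k : ℝ) + a ≤ √T := fun k => by
    rw [← Nat.succ_le_iff, hM, Nat.le_floor_iff (by linarith)]
    push_cast
    constructor <;> intro h <;> linarith
  -- `n j` is the number of lattice points on the line with one coordinate equal to `j`
  set n : ℕ → ℕ := fun j => ⌊T / (j + a) - a + 1⌋₊ with hn
  have hlen : ∀ j < M, ((n j : ℝ) ≤ T / (j + a) - a + 1) ∧ M ≤ n j := by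
    intro j hj
    have hja : (0 : ℝ) < j + a := by positivity
    have h1 : √T ≤ T / (j + a) := by
      rw [le_div_iff₀ hja]
      nlinarith [(hltM j).1 hj, Real.sqrt_nonneg T]
    exact ⟨Nat.floor_le (by linarith), Nat.floor_le_floor (by linarith)⟩
  have hltn : ∀ i j : ℕ, ((i : ℝ) + a) * (j + a) ≤ T → j < n i := fun i j h => by
    have hia : (0 : ℝ) < i + a := by positivity
    rw [← le_div_iff₀' hia] at h
    rw [← Nat.succ_le_iff]
    exact Nat.le_floor (by push_cast; linarith)
  -- the points with first coordinate `j < M`, and those with second coordinate `j < M` and first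
  -- coordinate at least `M`
  have hsub : cornerCross 2 T a ⊆
      ⋃ j ∈ Finset.range M, (((Finset.range (n j)).image fun i => ![j, i]) ∪
        ((Finset.Ico M (n j)).image fun i => ![i, j]) : Finset (Fin 2 → ℕ)) := by
    intro x hx
    have hx' : ((x 0 : ℝ) + a) * (x 1 + a) ≤ T := by
      simpa [cornerCross, Fin.prod_univ_two] using hx
    have hxe : x = ![x 0, x 1] := by ext i; fin_cases i <;> rfl
    simp only [Set.mem_iUnion, Finset.mem_coe, Finset.mem_union, Finset.mem_image, Finset.mem_range,
      Finset.mem_Ico]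
    by_cases h0 : x 0 < M
    · exact ⟨x 0, h0, Or.inl ⟨x 1, hltn _ _ hx', hxe.symm⟩⟩
    · have h1 : x 1 < M := by
        rw [hltM] at h0 ⊢
        by_contra h1
        push Not at h0 h1
        nlinarith [mul_lt_mul'' h0 h1 (Real.sqrt_nonneg T) (Real.sqrt_nonneg T)]
      exact ⟨x 1, h1, Or.inr ⟨x 0, ⟨not_lt.1 h0, hltn _ _ (by rwa [mul_comm])⟩, hxe.symm⟩⟩
  have hcard : (cornerCross 2 T a).ncard ≤ ∑ j ∈ Finset.range M, (n j + (n j - M)) := by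
    refine (Set.ncard_le_ncard hsub (Set.Finite.biUnion (Finset.finite_toSet _) fun k _ =>
      Finset.finite_toSet _)).trans ((Finset.set_ncard_biUnion_le _ _).trans
      (Finset.sum_le_sum fun j _ => ?_))
    rw [Set.ncard_coe_finset]
    refine (Finset.card_union_le _ _).trans (add_le_add ?_ ?_)
    · exact Finset.card_image_le.trans (by simp)
    · exact Finset.card_image_le.trans (by simp)
  calc ((cornerCross 2 T a).ncard : ℝ) ≤ ∑ j ∈ Finset.range M, ((n j + (n j - M) : ℕ) : ℝ) := by
        exact_mod_cast hcard
    _ ≤ _ := by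
        refine Finset.sum_le_sum fun j hj => ?_
        obtain ⟨h1, h2⟩ := hlen j (Finset.mem_range.1 hj)
        rw [Nat.cast_add, Nat.cast_sub h2]
        linarith

/-- The strict midpoint inequality for `∫ 1 / t` over `[x, x + 1]`. -/
theorem one_div_lt_log_div {x : ℝ} (hx : 0 < x) : 1 / (x + 1 / 2) < Real.log ((x + 1) / x) := by
  have h := Real.lt_log_one_add_of_pos (inv_pos.2 hx)
  convert h using 1
  · field_simp
    ring
  · congr 1
    field_simp

/-- Comparison of the harmonic sum with the logarithm, keeping the gain of the first term. -/
theorem sum_one_div_add_le_log {b : ℝ} (hb : 0 < b) {M : ℕ} (hM : 1 ≤ M) :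
    ∑ j ∈ Finset.range M, 1 / ((j : ℝ) + (b + 1 / 2)) ≤
      Real.log ((M + b) / b) - (Real.log ((b + 1) / b) - 1 / (b + 1 / 2)) := by
  induction M, hM using Nat.le_induction with
  | base => simp [add_comm]
  | succ M _ ih =>
    rw [Finset.sum_range_succ]
    have hMb : (0 : ℝ) < M + b := by positivity
    have h := (one_div_lt_log_div hMb).le
    have hlog : Real.log (((M + 1 : ℕ) + b) / b) =
        Real.log ((M + b) / b) + Real.log ((M + b + 1) / (M + b)) := by
      rw [← Real.log_mul (by positivity) (by positivity)]
      congr 1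
      push_cast
      field_simp
      ring
    rw [hlog, ← add_assoc]
    linarith

/-- The right-hand side is `∫ (T / x - b)` over `[b, T / b]`. -/
theorem le_smoothCrossVolume_two {T b : ℝ} (hb : 0 < b) (hbT : b ^ 2 ≤ T) :
    T * Real.log (T / b ^ 2) - T + b ^ 2 ≤ smoothCrossVolume 2 T b := by
  have hR : 0 ≤ T / b - b := by
    rw [sub_nonneg, le_div_iff₀ hb]; nlinarith
  have hT : 0 < T := (by positivity : 0 < b ^ 2).trans_le hbT
  have hne : (0 : ℝ) ∉ Set.uIcc b (T / b) := by
    rw [Set.uIcc_of_le (by linarith)]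
    exact fun h => absurd h.1 (by linarith)
  have hint : IntervalIntegrable (fun x : ℝ => T * (1 / x) - b) volume b (T / b) := by
    refine ((intervalIntegral.intervalIntegrable_one_div (fun x hx => ?_)
      continuousOn_id).const_mul T).sub intervalIntegrable_const
    rintro rfl
    exact hne hx
  have hval : ∫ x in (0 : ℝ)..(T / b - b), (T * (1 / (x + b)) - b) =
      T * Real.log (T / b ^ 2) - T + b ^ 2 := by
    rw [intervalIntegral.integral_comp_add_right (fun x => T * (1 / x) - b) b, zero_add,
      sub_add_cancel, intervalIntegral.integral_sub, intervalIntegral.integral_const_mul,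
      integral_one_div hne, intervalIntegral.integral_const]
    · rw [div_div, ← sq, smul_eq_mul]
      field_simp
      ring
    · exact (intervalIntegral.intervalIntegrable_one_div
        (fun x hx => by rintro rfl; exact hne hx) continuousOn_id).const_mul T
    · exact intervalIntegrable_const
  rw [← hval, smoothCrossVolume_eq_toReal, intervalIntegral.integral_of_le hR]
  have hint' : IntegrableOn (fun x : ℝ => T * (1 / (x + b)) - b) (Set.Ioc 0 (T / b - b)) := by
    have := hint.comp_add_right b
    rw [sub_self, intervalIntegrable_iff_integrableOn_Ioc_of_le hR] at this
    exact this
  have hnonneg : ∀ᵐ x ∂volume.restrict (Set.Ioc 0 (T / b - b)), 0 ≤ T * (1 / (x + b)) - b := by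
    refine ae_restrict_of_forall_mem measurableSet_Ioc fun x hx => ?_
    have hxb : 0 < x + b := by linarith [hx.1]
    rw [mul_one_div, sub_nonneg, le_div_iff₀ hxb]
    have := (le_div_iff₀ hb).1 (show x + b ≤ T / b by linarith [hx.2])
    linarith
  rw [← ENNReal.ofReal_le_iff_le_toReal (volume_smoothCross_lt_top _ _ hb).ne,
    ofReal_integral_eq_lintegral_ofReal hint' hnonneg, volume_smoothCross_succ _ _ hb]
  refine (lintegral_mono_set (t := Set.Ici 0) fun x hx => hx.1.le).trans
    (lintegral_mono fun x => ?_)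
  rw [volume_smoothCross_one, mul_one_div]

/-- In dimension two the volume exceeds the cardinality by a positive multiple of `T`: the gain in
the midpoint rule for `1 / x` on the first interval beats the error `O(√T)` of the hyperbola
method. -/
theorem linear_gain_two {a : ℝ} (ha : 1 / 2 < a) :
    ∃ c > 0, ∃ T₀, ∀ T, T₀ ≤ T → ((cornerCross 2 T a).ncard : ℝ) + c * T ≤
      smoothCrossVolume 2 T (a - 1 / 2) := by
  obtain ⟨b, rfl⟩ : ∃ b, a = b + 1 / 2 := ⟨a - 1 / 2, by ring⟩
  have hb : 0 < b := by linarith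
  rw [add_sub_cancel_right]
  set δ : ℝ := Real.log ((b + 1) / b) - 1 / (b + 1 / 2) with hδ
  have hδ0 : 0 < δ := sub_pos.2 (one_div_lt_log_div hb)
  -- the threshold makes `√T` at least `(2 * b + 6) / δ`, so that `δ * T` exceeds all terms in `√T`
  refine ⟨δ, hδ0, (b + 1 + (2 * b + 6) / δ) ^ 2, fun T hT => ?_⟩
  have hr : b + 1 + (2 * b + 6) / δ ≤ √T := Real.le_sqrt_of_sq_le hT
  have hq : 0 < (2 * b + 6) / δ := by positivity
  have hT0 : 0 < T := lt_of_lt_of_le (by positivity) hT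
  have hrT : √T ^ 2 = T := Real.sq_sqrt hT0.le
  set r := √T with hrdef
  have hr0 : 0 < r := by linarith
  have hN := ncard_cornerCross_two_le (T := T) (a := b + 1 / 2) (by linarith)
    (by nlinarith)
  have hV := le_smoothCrossVolume_two (T := T) hb (by nlinarith)
  rw [← hrdef] at hN
  set M := ⌊r - (b + 1 / 2) + 1⌋₊ with hM
  have hM1 : 1 ≤ M := Nat.le_floor (by push_cast; linarith)
  have hMle : (M : ℝ) ≤ r - (b + 1 / 2) + 1 := Nat.floor_le (by linarith)
  have hMgt : r - (b + 1 / 2) < M := by linarith [Nat.lt_floor_add_one (r - (b + 1 / 2) + 1)]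
  have hS := sum_one_div_add_le_log hb hM1
  rw [← hδ] at hS
  set S := ∑ j ∈ Finset.range M, 1 / ((j : ℝ) + (b + 1 / 2)) with hSdef
  have hNS : ∑ j ∈ Finset.range M, (2 * (T / (j + (b + 1 / 2)) - (b + 1 / 2) + 1) - (M : ℝ)) =
      2 * T * S + M * (1 - 2 * b) - M ^ 2 := by
    have hterm : ∀ j : ℕ, 2 * (T / (j + (b + 1 / 2)) - (b + 1 / 2) + 1) - (M : ℝ) =
        2 * T * (1 / (j + (b + 1 / 2))) + (1 - 2 * b - M) := fun j => by ring
    simp only [hterm]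
    rw [Finset.sum_add_distrib, Finset.sum_const, Finset.card_range, nsmul_eq_mul,
      ← Finset.mul_sum]
    ring
  -- `log ((M + b) / b) ≤ log (r / b) + 1 / (2 r)`, since `M + b ≤ r + 1 / 2`
  have hlog : Real.log ((M + b) / b) ≤ Real.log (r / b) + 1 / (2 * r) := by
    have h1 : Real.log ((M + b) / r) ≤ (M + b) / r - 1 := Real.log_le_sub_one_of_pos (by positivity)
    have h2 : (M + b) / r - 1 ≤ 1 / (2 * r) := by
      rw [sub_le_iff_le_add, div_le_iff₀ hr0]
      field_simp
      linarith
    have h3 : Real.log ((M + b) / b) = Real.log (r / b) + Real.log ((M + b) / r) := by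
      rw [← Real.log_mul (by positivity) (by positivity)]
      congr 1
      field_simp
    linarith
  have hlogT : Real.log (T / b ^ 2) = 2 * Real.log (r / b) := by
    rw [← hrT, ← div_pow, Real.log_pow]
    norm_num
  have hTS : 2 * T * S ≤ 2 * T * Real.log (r / b) + r - 2 * δ * T := by
    have h1 : 2 * T * S ≤ 2 * T * (Real.log (r / b) + 1 / (2 * r) - δ) :=
      mul_le_mul_of_nonneg_left (by linarith) (by positivity)
    have h2 : 2 * T * (1 / (2 * r)) = r := by
      rw [← hrT]; field_simp
    nlinarith
  have hMsq : (r - (b + 1 / 2)) ^ 2 ≤ (M : ℝ) ^ 2 := pow_le_pow_left₀ (by linarith) hMgt.le 2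
  have hMb : M * (1 - 2 * b) ≤ r + 1 := by nlinarith
  have hδT : (2 * b + 6) * r ≤ δ * T := by
    have h1 : 2 * b + 6 ≤ δ * r := by
      rw [← div_le_iff₀' hδ0]; linarith
    nlinarith
  rw [hNS] at hN
  rw [hlogT] at hV
  nlinarith

/-! ### The inequality in every dimension -/

theorem mainTheorem3 (s : ℕ) (hs : 2 ≤ s) (a : ℝ) (ha : 1 / 2 < a) :
    ∃ Tstar : ℝ, 0 < Tstar ∧ ∀ T : ℝ, Tstar ≤ T →
      (cornerCross s T a).Finite ∧
        ((cornerCross s T a).ncard : ℝ) ≤ smoothCrossVolume s T (a - 1 / 2) := by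
  obtain ⟨c, hc, h⟩ : ∃ c > 0, ∃ T₀, ∀ T, T₀ ≤ T → ((cornerCross s T a).ncard : ℝ) + c * T ≤
      smoothCrossVolume s T (a - 1 / 2) := by
    induction s, hs using Nat.le_induction with
    | base => exact linear_gain_two ha
    | succ s hs ih =>
      obtain ⟨c, hc, T₀, h⟩ := ih
      obtain ⟨s, rfl⟩ := Nat.exists_eq_add_of_le' (show 1 ≤ s by omega)
      exact ⟨c, hc, linear_gain_succ s ha hc h⟩
  obtain ⟨T₀, h⟩ := h
  refine ⟨max T₀ 1, by positivity, fun T hT => ⟨cornerCross_finite s T (by linarith), ?_⟩⟩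
  have hT0 : 0 < T := one_pos.trans_le ((le_max_right _ _).trans hT)
  linarith [h T ((le_max_left _ _).trans hT), mul_pos hc hT0]
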